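/- Let $L$ be an even, integral, non-degenerate lattice with bilinear form $(\cdot,\cdot)$ and signature $(b^+,b^-)$, let $L'=\{x\in L\otimes\mathbb{Q} : (x,y)\in\mathbb{Z}\ \text{for all } y\in L\}$, $A=L'/L$, $q(x)=\tfrac12(x,x)$, $W=L\otimes\mathbb{R}$ and $e(x)=\exp(2\pi i x)$. For a positive integer $r$ let $L(r)$ be the lattice $L$ with the form $r(\cdot,\cdot)$, let $A(r)=L(r)'/L=\tfrac1rL'/L$ and $q_r=rq$; thus $A(l)\subseteq A(r)\subseteq W/L$ for $l\mid r$. Let $\mathrm{Mp}_2(\mathbb{Z})$ be the group of pairs $(M,\phi)$ with $M=\begin{pmatrix}a&b\\c&d\end{pmatrix}\in\mathrm{SL}_2(\mathbb{Z})$ and $\phi$ holomorphic on the upper half-plane $\mathbb{H}$ with $\phi(\tau)^2=c\tau+d$, with product $(M_1,\phi_1)(M_2,\phi_2)=(M_1M_2,\phi_1(M_2\tau)\phi_2(\tau))$. The Weil representation $\rho_L$ of $\mathrm{Mp}_2(\mathbb{Z})$ on $\mathbb{C}[A]$ (basis $e_\lambda$, $\lambda\in A$) is given on the generators $T=(\begin{pmatrix}1&1\\0&1\end{pmatrix},1)$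 and $S=(\begin{pmatrix}0&-1\\1&0\end{pmatrix},\sqrt\tau)$ by $$\rho_L(T)e_\lambda=e(q(\lambda))\,e_\lambda,\qquad \rho_L(S)e_\lambda=\frac{e(-(b^+-b^-)/8)}{\sqrt{|A|}}\sum_{\mu\in A}e(-(\lambda,\mu))\,e_\mu .$$ Let $v,\bar v\in\tfrac12\mathbb{Z}$ and $(w,\bar w)=(v+\tfrac{b^+}2,\bar v+\tfrac{b^-}2)$. Let $\psi=\sum_{\lambda\in A}\psi_\lambda e_\lambda$ be vector-valued modular of weight $(v,\bar v)$ and type $\rho_L$, that is, a real analytic function $\psi:\mathbb{H}\times W\times W\to\mathbb{C}[A]$ with $$\psi(M\tau,a\alpha+b\beta,c\alpha+d\beta)=\phi(\tau)^{2v}\,\overline{\phi(\tau)}^{\,2\bar v}\,\rho_L(M,\phi)\,\psi(\tau,\alpha,\beta)\qquad\text{for all }(M,\phi)\in\mathrm{Mp}_2(\mathbb{Z})$$ (functions of $\tau$ alone are included). For $kl=r$ and $\mu\in A(r)$ let $\Delta_r(\mu,k)$ be $1$ if $\mu\in A(l)$ and $0$ otherwise. The operators $\mathcal{T}_r$, from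 $\mathbb{C}[A]$-valued to $\mathbb{C}[A(r)]$-valued functions, and $\mathcal{U}_{n^2}$, from $\mathbb{C}[A]$-valued to $\mathbb{C}[A(n^2)]$-valued functions, are defined for all positive integers $r,n$ by $$\mathcal{T}_r[\psi](\tau,\alpha,\beta)=r^{w+\bar w-1}\sum_{\mu\in A(r)}\Bigg(\sum_{\substack{k,l>0\\kl=r}}\frac1{l^{w+\bar w}}\sum_{s=0}^{l-1}\Delta_r(\mu,k)\,e\!\left(-\frac sk q_r(\mu)\right)\psi_{l\mu}\!\left(\frac{k\tau+s}l,\,k\alpha+s\beta,\,l\beta\right)\Bigg)e_\mu,$$ $$\mathcal{U}_{n^2}[\psi](\tau,\alpha,\beta)=\sum_{\nu\in A(n^2)}\Delta_{n^2}(\nu,n)\,\psi_{n\nu}(\tau,n\alpha,n\beta)\,e_\nu,$$ and in the same way for the rescaled lattices $L(n)$ in place of $L$, with the same $(w,\bar w)$. Lattices $L(a)(b)$ and $L(ab)$ are identified. Then, for every such $\psi$: for all positive integers $m,n$ with $\gcd(m,n)=1$, $$\mathcal{T}_m[\mathcal{T}_n[\psi]]=\mathcal{T}_{mn}[\psi],$$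 and for every prime $p$ and every integer $l\ge2$, $$\mathcal{T}_{p^l}[\psi]=\mathcal{T}_p[\mathcal{T}_{p^{l-1}}[\psi]]-p^{w+\bar w-1}\,\mathcal{U}_{p^2}[\mathcal{T}_{p^{l-2}}[\psi]].$$ -/

import Mathlib

open UpperHalfPlane
open scoped MatrixGroups Manifold ComplexConjugate

set_option linter.unusedSectionVars false

noncomputable section

/-- `e(x) = exp(2πix)`. -/
def expTwoPi (x : ℝ) : ℂ := Complex.exp (2 * Real.pi * Complex.I * x)

/-! ### The metaplectic group -/

/-- Elements of `Mp₂(ℤ)`: pairs `(M, φ)` with `M ∈ SL₂(ℤ)` and `φ` a holomorphic function on the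
upper half-plane with `φ(τ)² = cτ + d`. -/
@[ext]
structure Mp2Z where
  /-- the matrix -/
  mat : SL(2, ℤ)
  /-- the chosen square root of `cτ + d` -/
  root : ℍ → ℂ
  holo : MDifferentiable 𝓘(ℂ) 𝓘(ℂ) root
  sq : ∀ τ : ℍ, root τ ^ 2 = (mat 1 0 : ℂ) * (τ : ℂ) + (mat 1 1 : ℂ)

namespace Mp2Z

theorem mdiff_smul (M : SL(2, ℤ)) : MDifferentiable 𝓘(ℂ) 𝓘(ℂ) (fun τ : ℍ => M • τ) := by
  have h : 0 < ((M : SL(2, ℝ)) : GL (Fin 2) ℝ).det.val := by simp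
  exact UpperHalfPlane.mdifferentiable_smul h

theorem sq_denom (g : Mp2Z) (τ : ℍ) : g.root τ ^ 2 = denom g.mat τ := by
  rw [g.sq, ModularGroup.denom_apply]

theorem root_ne_zero (g : Mp2Z) (τ : ℍ) : g.root τ ≠ 0 := by
  intro h
  have h1 := g.sq_denom τ
  rw [h] at h1
  exact denom_ne_zero (g.mat : GL (Fin 2) ℝ) τ (by simpa using h1.symm)

theorem cocycle (A B : SL(2, ℤ)) (τ : ℍ) :
    ((A 1 0 : ℂ) * ((B • τ : ℍ) : ℂ) + (A 1 1 : ℂ)) * ((B 1 0 : ℂ) * (τ : ℂ) + (B 1 1 : ℂ)) =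
      ((A * B) 1 0 : ℂ) * (τ : ℂ) + ((A * B) 1 1 : ℂ) := by
  have hd : (B 1 0 : ℂ) * (τ : ℂ) + (B 1 1 : ℂ) ≠ 0 := by
    rw [← ModularGroup.denom_apply]; exact denom_ne_zero _ τ
  rw [UpperHalfPlane.coe_specialLinearGroup_apply]
  simp only [algebraMap_int_eq, eq_intCast, Complex.ofReal_intCast,
    Matrix.SpecialLinearGroup.coe_mul, Matrix.mul_apply, Fin.sum_univ_two]
  have key : ∀ a b n D : ℂ, D ≠ 0 → (a * (n / D) + b) * D = a * n + b * D := by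
    intro a b n D hD
    field_simp
  rw [key _ _ _ _ hd]
  push_cast
  ring

/-- `(M₁, φ₁)(M₂, φ₂) = (M₁M₂, φ₁(M₂τ)φ₂(τ))`. -/
instance : Mul Mp2Z where
  mul g h :=
    { mat := g.mat * h.mat
      root := fun τ => g.root (h.mat • τ) * h.root τ
      holo := (g.holo.comp (mdiff_smul h.mat)).mul h.holo
      sq := by
        intro τ
        rw [mul_pow, g.sq, h.sq, cocycle] }

instance : One Mp2Z where
  one :=
    { mat := 1
      root := fun _ => 1
      holo := mdifferentiable_const
      sq := by intro τ; simp }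

instance : Inv Mp2Z where
  inv g :=
    { mat := g.mat⁻¹
      root := fun τ => (g.root (g.mat⁻¹ • τ))⁻¹
      holo := by
        have h := g.holo.comp (mdiff_smul g.mat⁻¹)
        rw [UpperHalfPlane.mdifferentiable_iff] at h ⊢
        exact h.inv fun z _ => g.root_ne_zero _
      sq := by
        intro τ
        have h := cocycle g.mat g.mat⁻¹ τ
        rw [← g.sq] at h
        rw [inv_pow, inv_eq_iff_eq_inv]
        exact eq_inv_of_mul_eq_one_left (h.trans (by simp)) }

@[simp] theorem mul_mat (g h : Mp2Z) : (g * h).mat = g.mat * h.mat := rfl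
@[simp] theorem mul_root (g h : Mp2Z) (τ : ℍ) :
    (g * h).root τ = g.root (h.mat • τ) * h.root τ := rfl
@[simp] theorem one_mat : (1 : Mp2Z).mat = 1 := rfl
@[simp] theorem one_root (τ : ℍ) : (1 : Mp2Z).root τ = 1 := rfl
@[simp] theorem inv_mat (g : Mp2Z) : (g⁻¹).mat = g.mat⁻¹ := rfl
@[simp] theorem inv_root (g : Mp2Z) (τ : ℍ) :
    (g⁻¹).root τ = (g.root (g.mat⁻¹ • τ))⁻¹ := rfl

instance : Group Mp2Z :=
  Group.ofLeftAxioms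
    (by intro a b c
        ext τ
        · simp [mul_assoc]
        · simp [mul_assoc, mul_smul])
    (by intro a; ext τ <;> simp)
    (by intro a
        ext τ
        · simp
        · simp [a.root_ne_zero])

/-- `T = ((1 1; 0 1), 1)`. -/
def T : Mp2Z where
  mat := ModularGroup.T
  root := fun _ => 1
  holo := mdifferentiable_const
  sq := by intro τ; simp [ModularGroup.T]

/-- `S = ((0 -1; 1 0), √τ)`, with the principal branch of the square root. -/
def S : Mp2Z where
  mat := ModularGroup.S
  root := fun τ => (τ : ℂ) ^ (1 / 2 : ℂ)
  holo := by
    rw [UpperHalfPlane.mdifferentiable_iff]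
    have h : DifferentiableOn ℂ (fun z : ℂ => z ^ (1 / 2 : ℂ)) {z | 0 < z.im} := fun z hz =>
      (differentiableAt_id.cpow_const (Or.inr (ne_of_gt hz))).differentiableWithinAt
    refine h.congr fun z hz => ?_
    simp [UpperHalfPlane.ofComplex_apply_of_im_pos hz]
  sq := by
    intro τ
    rw [← Complex.cpow_nat_mul]
    simp [ModularGroup.S]

/-- `Mp₂(ℤ)` is generated by `S` and `T`, even as a monoid. -/
theorem closure_S_T : Submonoid.closure {T, S} = (⊤ : Submonoid Mp2Z) := by
  set H : Submonoid Mp2Z := Submonoid.closure {T, S} with hH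
  have hT : T ∈ H := Submonoid.subset_closure (by simp)
  have hS : S ∈ H := Submonoid.subset_closure (by simp)
  -- an element over `-1` has fourth power `1` and square `(1, -1)`
  have hneg : ∀ g : Mp2Z, g.mat = -1 → (g * g).mat = 1 ∧ (∀ τ, (g * g).root τ = -1) := by
    intro g hg
    refine ⟨by simp [hg], fun τ => ?_⟩
    have h := g.sq τ
    simp only [mul_root, hg]
    simp [hg] at h
    rw [← h, _root_.sq]
    simp
  have hneg4 : ∀ g : Mp2Z, g.mat = -1 → (g * g) * (g * g) = 1 := by
    intro g hg
    obtain ⟨h1, h2⟩ := hneg g hg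
    ext1
    · rw [mul_mat, h1]; simp
    · funext τ
      rw [mul_root, h2, h2]; simp
  have hS2 : (S * S).mat = -1 := by
    change ModularGroup.S * ModularGroup.S = -1
    decide
  have hST : (S * T * (S * T) * (S * T)).mat = -1 := by
    change ModularGroup.S * ModularGroup.T * (ModularGroup.S * ModularGroup.T) *
      (ModularGroup.S * ModularGroup.T) = -1
    decide
  have hSinv : S⁻¹ ∈ H := by
    have h := hneg4 _ hS2
    have : S⁻¹ = S * (S * S) * (S * S) * (S * S) := by
      rw [inv_eq_iff_mul_eq_one, ← h]
      simp only [mul_assoc]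
    rw [this]
    exact H.mul_mem (H.mul_mem (H.mul_mem hS (H.mul_mem hS hS)) (H.mul_mem hS hS))
      (H.mul_mem hS hS)
  have hTinv : T⁻¹ ∈ H := by
    have h := hneg4 _ hST
    set w := S * T * (S * T) * (S * T) with hw
    have hwm : w ∈ H := by
      have := H.mul_mem hS hT
      exact H.mul_mem (H.mul_mem this this) this
    have h1 : T * (w * w * w * (S * T) * (S * T) * S) = 1 := by
      have h2 : w * w * w * (S * T) * (S * T) * (S * T) = 1 := by
        rw [← h]; simp only [hw, mul_assoc]
      have h3 : w * w * w * (S * T) * (S * T) * S * T = 1 := by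
        rw [← h2]; simp only [mul_assoc]
      exact mul_eq_one_comm.1 h3
    rw [inv_eq_of_mul_eq_one_right h1]
    have hp := H.mul_mem hS hT
    exact H.mul_mem (H.mul_mem (H.mul_mem (H.mul_mem (H.mul_mem hwm hwm) hwm) hp) hp) hS
  -- the central element `(1, -1)`
  have hker : ∀ g : Mp2Z, g.mat = 1 → g ∈ H := by
    intro g hg
    have hsq : ∀ τ, g.root τ ^ 2 = 1 := by intro τ; rw [g.sq, hg]; simp
    have hor : (∀ τ, g.root τ = 1) ∨ (∀ τ, g.root τ = -1) := by
      have hc : ContinuousOn g.root Set.univ := g.holo.continuous.continuousOn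
      have := isPreconnected_univ.eq_one_or_eq_neg_one_of_sq_eq hc
        (fun {τ} _ => by simpa using hsq τ)
      rcases this with h | h
      · exact Or.inl fun τ => h (Set.mem_univ τ)
      · exact Or.inr fun τ => h (Set.mem_univ τ)
    rcases hor with h | h
    · have : g = 1 := by
        ext1
        · simpa using hg
        · funext τ; simpa using h τ
      rw [this]; exact H.one_mem
    · have : g = (S * S) * (S * S) := by
        obtain ⟨h1, h2⟩ := hneg _ hS2
        ext1
        · rw [h1, hg]
        · funext τ; rw [h2, h]
      rw [this]
      exact H.mul_mem (H.mul_mem hS hS) (H.mul_mem hS hS)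
  have hlift : ∀ M : SL(2, ℤ), ∃ g ∈ H, g⁻¹ ∈ H ∧ g.mat = M := by
    intro M
    have hM : M ∈ Subgroup.closure {ModularGroup.S, ModularGroup.T} := by
      rw [SpecialLinearGroup.SL2Z_generators]; trivial
    induction hM using Subgroup.closure_induction with
    | mem x hx =>
      rcases hx with rfl | rfl
      · exact ⟨S, hS, hSinv, rfl⟩
      · exact ⟨T, hT, hTinv, rfl⟩
    | one => exact ⟨1, H.one_mem, by simp, rfl⟩
    | mul x y _ _ hx hy =>
      obtain ⟨a, ha, ha', rfl⟩ := hx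
      obtain ⟨b, hb, hb', rfl⟩ := hy
      exact ⟨a * b, H.mul_mem ha hb, by rw [mul_inv_rev]; exact H.mul_mem hb' ha', rfl⟩
    | inv x _ hx =>
      obtain ⟨a, ha, ha', rfl⟩ := hx
      exact ⟨a⁻¹, ha', by simpa using ha, rfl⟩
  rw [eq_top_iff]
  intro g _
  obtain ⟨a, ha, -, hag⟩ := hlift g.mat
  have := H.mul_mem ha (hker (a⁻¹ * g) (by simp [hag]))
  simpa using this

end Mp2Z

/-! ### Lattices, discriminant groups, Weil representation -/

variable {V : Type*} [NormedAddCommGroup V] [NormedSpace ℝ V] [FiniteDimensional ℝ V]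

/-- `L'/L` as a subgroup of `V/L`, where `L' = {x | ∀ y ∈ L, B(x, y) ∈ ℤ}`. -/
def discGroup (B : LinearMap.BilinForm ℝ V) (L : Submodule ℤ V) : Submodule ℤ (V ⧸ L) :=
  (B.dualSubmodule L).map L.mkQ

variable (V) in
/-- An even, integral, non-degenerate lattice `L` with `L ⊗ ℝ = V`. The bilinear form is given
through its real extension to `V`. -/
structure EvenLattice where
  /-- the lattice -/
  L : Submodule ℤ V
  /-- the real extension of the bilinear form on the lattice -/
  form : LinearMap.BilinForm ℝ V
  discrete : DiscreteTopology L
  span_eq_top : Submodule.span ℝ (L : Set V) = ⊤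
  symm : form.IsSymm
  nondegenerate : form.Nondegenerate
  integral : ∀ x ∈ L, ∀ y ∈ L, ∃ n : ℤ, form x y = n
  even : ∀ x ∈ L, ∃ n : ℤ, form x x = 2 * n

namespace EvenLattice

variable (Λ : EvenLattice V)

/-- `b⁺` -/
def bPos : ℕ := sigPos (LinearMap.BilinMap.toQuadraticMap Λ.form)

/-- `b⁻` -/
def bNeg : ℕ := sigNeg (LinearMap.BilinMap.toQuadraticMap Λ.form)

/-- The rescaled lattice `L(r)`: the same group with the form `r(·,·)`. -/
def rescale (r : ℕ+) : EvenLattice V where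
  L := Λ.L
  form := (r : ℝ) • Λ.form
  discrete := Λ.discrete
  span_eq_top := Λ.span_eq_top
  symm := ⟨fun x y => by simp [Λ.symm.eq x y]⟩
  nondegenerate :=
    ⟨fun x hx => Λ.nondegenerate.1 x fun y => by simpa using hx y,
      fun y hy => Λ.nondegenerate.2 y fun x => by simpa using hy x⟩
  integral := by
    intro x hx y hy
    obtain ⟨n, hn⟩ := Λ.integral x hx y hy
    exact ⟨r * n, by simp [hn]⟩
  even := by
    intro x hx
    obtain ⟨n, hn⟩ := Λ.even x hx
    exact ⟨r * n, by simp [hn]; ring⟩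

/-- The discriminant group `A = L'/L ⊆ V/L`. For the rescaled lattices, `A(r) = L(r)'/L` is
again a subgroup of `V/L`, so that `A ⊆ A(l) ⊆ A(r)` for `l ∣ r`. -/
abbrev A : Submodule ℤ (V ⧸ Λ.L) := discGroup Λ.form Λ.L

instance finite_A : Finite Λ.A := by
  classical
  have := Λ.discrete
  have : IsZLattice ℝ Λ.L := ⟨Λ.span_eq_top⟩
  have : Module.Free ℤ Λ.L := ZLattice.module_free ℝ Λ.L
  have : Module.Finite ℤ Λ.L := ZLattice.module_finite ℝ Λ.L
  let b := (Module.Free.chooseBasis ℤ Λ.L).ofZLatticeBasis ℝ Λ.L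
  have hb : Submodule.span ℤ (Set.range b) = Λ.L :=
    (Module.Free.chooseBasis ℤ Λ.L).ofZLatticeBasis_span ℝ
  let d := Λ.form.dualBasis Λ.nondegenerate b
  have hd : Λ.form.dualSubmodule Λ.L = Submodule.span ℤ (Set.range d) := by
    rw [← Λ.form.dualSubmodule_span_of_basis Λ.nondegenerate b, hb]
  have hle : Λ.L ≤ Λ.form.dualSubmodule Λ.L := fun x hx y hy => by
    obtain ⟨n, hn⟩ := Λ.integral x hx y hy
    exact Submodule.mem_one.2 ⟨n, by simp [hn]⟩
  have : Module.Free ℤ (Λ.form.dualSubmodule Λ.L) := by rw [hd]; infer_instance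
  have : Module.Finite ℤ (Λ.form.dualSubmodule Λ.L) := by rw [hd]; infer_instance
  have hr : Module.finrank ℤ (Λ.L.submoduleOf (Λ.form.dualSubmodule Λ.L)) =
      Module.finrank ℤ (Λ.form.dualSubmodule Λ.L) := by
    rw [(Submodule.submoduleOfEquivOfLe hle).finrank_eq, ZLattice.rank ℝ Λ.L, hd,
      ZLattice.rank ℝ (Submodule.span ℤ (Set.range d))]
  have := Submodule.finiteQuotientOfFreeOfRankEq _ hr
  let f : (Λ.form.dualSubmodule Λ.L ⧸ Λ.L.submoduleOf (Λ.form.dualSubmodule Λ.L)) →ₗ[ℤ]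
      V ⧸ Λ.L := Submodule.mapQ _ _ (Λ.form.dualSubmodule Λ.L).subtype le_rfl
  refine Set.Finite.subset (Set.finite_range f) ?_
  rintro _ ⟨x, hx, rfl⟩
  exact ⟨Submodule.Quotient.mk ⟨x, hx⟩, rfl⟩

instance : Fintype Λ.A := Fintype.ofFinite _

/-- A real number representing `q(λ) = (λ, λ)/2`, computed from a representative of the class
`λ`; for `λ ∈ A` its class modulo `ℤ` does not depend on the representative. -/
def q (x : V ⧸ Λ.L) : ℝ := Λ.form x.out x.out / 2

/-- A real number representing `(λ, μ)`, computed from representatives of the classes `λ` and `μ`;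
for `λ, μ ∈ A` its class modulo `ℤ` does not depend on the representatives. -/
def pairing (x y : V ⧸ Λ.L) : ℝ := Λ.form x.out y.out

/-- Independence of the representative. -/
theorem q_eq (x : V) (hx : x ∈ Λ.form.dualSubmodule Λ.L) :
    ∃ n : ℤ, Λ.q (Λ.L.mkQ x) = Λ.form x x / 2 + n := by
  obtain ⟨y, hy, hxy⟩ : ∃ y ∈ Λ.L, (Λ.L.mkQ x).out = x + y :=
    ⟨(Λ.L.mkQ x).out - x, (Submodule.Quotient.eq _).1 (Quotient.out_eq _), by abel⟩
  obtain ⟨a, ha⟩ := Submodule.mem_one.1 (hx y hy)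
  obtain ⟨b, hb⟩ := Λ.even y hy
  refine ⟨a + b, ?_⟩
  have hs := Λ.symm.eq x y
  simp only [q, hxy, map_add, LinearMap.add_apply, hb, ← hs, ← ha, eq_intCast, algebraMap_int_eq]
  push_cast
  ring

theorem rescale_q (r : ℕ+) (z : V ⧸ Λ.L) : (Λ.rescale r).q z = r * Λ.q z := by
  change (r : ℝ) * Λ.form z.out z.out / 2 = r * (Λ.form z.out z.out / 2)
  ring

/-- For `il = r` and `x ∈ L(l)'`, the class of `(s/i) q_r(x)` modulo `ℤ` does not depend on the
representative: it is `s q_l(x)`. -/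
theorem phase_eq (i l r : ℕ+) (h : i * l = r) (s : ℕ) (x : V)
    (hx : x ∈ ((l : ℝ) • Λ.form).dualSubmodule Λ.L) :
    ∃ n : ℤ, (s : ℝ) / i * (Λ.rescale r).q (Λ.L.mkQ x) = s * (l * Λ.form x x / 2) + n := by
  obtain ⟨n, hn⟩ := (Λ.rescale l).q_eq x hx
  refine ⟨s * n, ?_⟩
  have hi : (i : ℝ) ≠ 0 := by exact_mod_cast i.ne_zero
  have h1 : (Λ.rescale r).q (Λ.L.mkQ x) = i * (Λ.rescale l).q (Λ.L.mkQ x) := by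
    rw [rescale_q, rescale_q, ← h]
    push_cast
    ring
  have h2 : (Λ.rescale l).q (Λ.L.mkQ x) = l * Λ.form x x / 2 + n := hn.trans (by simp [rescale])
  rw [h1, h2]
  push_cast
  field_simp

/-- Independence of the representatives. -/
theorem pairing_eq (x y : V) (hx : x ∈ Λ.form.dualSubmodule Λ.L)
    (hy : y ∈ Λ.form.dualSubmodule Λ.L) :
    ∃ n : ℤ, Λ.pairing (Λ.L.mkQ x) (Λ.L.mkQ y) = Λ.form x y + n := by
  obtain ⟨u, hu, hxu⟩ : ∃ u ∈ Λ.L, (Λ.L.mkQ x).out = x + u :=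
    ⟨(Λ.L.mkQ x).out - x, (Submodule.Quotient.eq _).1 (Quotient.out_eq _), by abel⟩
  obtain ⟨w, hw, hyw⟩ : ∃ w ∈ Λ.L, (Λ.L.mkQ y).out = y + w :=
    ⟨(Λ.L.mkQ y).out - y, (Submodule.Quotient.eq _).1 (Quotient.out_eq _), by abel⟩
  obtain ⟨a, ha⟩ := Submodule.mem_one.1 (hx w hw)
  obtain ⟨b, hb⟩ := Submodule.mem_one.1 (hy u hu)
  obtain ⟨c, hc⟩ := Λ.integral u hu w hw
  refine ⟨a + b + c, ?_⟩
  have hs := Λ.symm.eq y u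
  simp only [pairing, hxu, hyw, map_add, LinearMap.add_apply, hc, ← hs, ← ha, ← hb, eq_intCast,
    algebraMap_int_eq]
  push_cast
  ring

/-- `ℂ[A]`, an element being given by its coefficients in the basis `(e_λ)`. -/
abbrev GroupAlg : Type _ := Λ.A → ℂ

/-- The coefficient of `e_x` of an element of `ℂ[A]`, with the value `0` if `x ∉ A`. -/
def coeff (f : Λ.GroupAlg) (x : V ⧸ Λ.L) : ℂ := by
  classical exact if h : x ∈ Λ.A then f ⟨x, h⟩ else 0

/-- `ρ_L(T) e_λ = e(q(λ)) e_λ`. -/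
def weilT : Module.End ℂ Λ.GroupAlg :=
  LinearMap.pi fun l => expTwoPi (Λ.q l) • LinearMap.proj l

/-- `ρ_L(S) e_λ = e(-sgn(L)/8)/√|A| ∑_μ e(-(λ, μ)) e_μ`. -/
def weilS : Module.End ℂ Λ.GroupAlg :=
  (expTwoPi (-((Λ.bPos : ℝ) - Λ.bNeg) / 8) / (Real.sqrt (Nat.card Λ.A) : ℂ)) •
    LinearMap.pi fun m : Λ.A =>
      ∑ l : Λ.A, expTwoPi (-Λ.pairing l m) • (LinearMap.proj l : Λ.GroupAlg →ₗ[ℂ] ℂ)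

/-- The graph of the Weil representation `ρ_L` of `Mp₂(ℤ)` on `ℂ[A]`: the smallest
multiplicatively closed set of pairs containing `(1, id)`, `(T, ρ_L(T))` and `(S, ρ_L(S))`. So
`(g, R)` belongs to it iff `R = ρ_L(g)`; see `exists_mem_weilGraph` and `mem_weilGraph_iff`. -/
def weilGraph : Submonoid (Mp2Z × Module.End ℂ Λ.GroupAlg) :=
  Submonoid.closure {(Mp2Z.T, Λ.weilT), (Mp2Z.S, Λ.weilS)}

theorem exists_mem_weilGraph (g : Mp2Z) : ∃ R, (g, R) ∈ Λ.weilGraph := by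
  have hg : g ∈ Submonoid.closure {Mp2Z.T, Mp2Z.S} := by rw [Mp2Z.closure_S_T]; trivial
  induction hg using Submonoid.closure_induction with
  | mem x hx =>
    rcases hx with rfl | rfl
    · exact ⟨Λ.weilT, Submonoid.subset_closure (by simp)⟩
    · exact ⟨Λ.weilS, Submonoid.subset_closure (by simp)⟩
  | one => exact ⟨1, Λ.weilGraph.one_mem⟩
  | mul x y _ _ hx hy =>
    obtain ⟨R, hR⟩ := hx
    obtain ⟨R', hR'⟩ := hy
    exact ⟨R * R', Λ.weilGraph.mul_mem hR hR'⟩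

/-- `weilGraph` is the graph of any representation of `Mp₂(ℤ)` that has the prescribed values on
the generators `T` and `S`. -/
theorem mem_weilGraph_iff (ρ : Representation ℂ Mp2Z Λ.GroupAlg) (hT : ρ Mp2Z.T = Λ.weilT)
    (hS : ρ Mp2Z.S = Λ.weilS) (g : Mp2Z) (R : Module.End ℂ Λ.GroupAlg) :
    (g, R) ∈ Λ.weilGraph ↔ R = ρ g := by
  have key : ∀ p ∈ Λ.weilGraph, p.2 = ρ p.1 := by
    intro p hp
    induction hp using Submonoid.closure_induction with
    | mem x hx =>
      rcases hx with rfl | rfl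
      · exact hT.symm
      · exact hS.symm
    | one => simp
    | mul x y _ _ hx hy => simp [hx, hy]
  refine ⟨fun h => key _ h, ?_⟩
  rintro rfl
  obtain ⟨R, hR⟩ := Λ.exists_mem_weilGraph g
  rwa [← key _ hR]

/-! ### Vector-valued modular forms -/

/-- `ℂ[A]`-valued functions `ψ(τ, α, β)` on `ℍ × W × W`, with `W = L ⊗ ℝ = V`. -/
abbrev VVFun : Type _ := ℍ → V → V → Λ.GroupAlg

/-- `ψ` is a real analytic function that is vector-valued modular of weight `(k/2, k'/2)` and
type `ρ_L`. -/
structure IsModular (k k' : ℤ) (ψ : Λ.VVFun) : Prop where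
  analytic : ∀ l : Λ.A, AnalyticOnNhd ℝ
    (fun p : ℂ × V × V => ψ (ofComplex p.1) p.2.1 p.2.2 l) {p | 0 < p.1.im}
  transform : ∀ (g : Mp2Z) (R : Module.End ℂ Λ.GroupAlg), (g, R) ∈ Λ.weilGraph →
    ∀ (τ : ℍ) (α β : V),
      ψ (g.mat • τ) (g.mat 0 0 • α + g.mat 0 1 • β) (g.mat 1 0 • α + g.mat 1 1 • β) =
        (g.root τ ^ k * conj (g.root τ) ^ k') • R (ψ τ α β)

/-! ### Hecke and scaling operators -/

/-- `w + w̄`, where `(w, w̄) = (v + b⁺/2, v̄ + b⁻/2)` and `(v, v̄) = (k/2, k'/2)`. -/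
def weightSum (k k' : ℤ) : ℝ := ((k : ℝ) / 2 + Λ.bPos / 2) + ((k' : ℝ) / 2 + Λ.bNeg / 2)

/-- `Δ_r(μ, k)` for `kl = r`: it is `1` if `μ ∈ A(l)` and `0` otherwise. -/
def delta (l : ℕ) (μ : V ⧸ Λ.L) : ℂ := by
  classical exact if μ ∈ discGroup ((l : ℝ) • Λ.form) Λ.L then 1 else 0

/-- The Hecke operator `𝒯_r` on functions of weight `(k/2, k'/2)`, from `ℂ[A]`-valued to
`ℂ[A(r)]`-valued functions: the coefficient of `e_μ` in `𝒯_r[ψ](τ)` is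
`r^(w+w̄-1) ∑_{il=r} l^(-w-w̄) ∑_{0≤s<l} Δ_r(μ,i) e(-(s/i) q_r(μ)) ψ_{lμ}((iτ+s)/l)`,
where the elliptic variables of `ψ` are `(iα+sβ, lβ)`. Here `p = (i, l)`. -/
def hecke (k k' : ℤ) (r : ℕ+) (ψ : Λ.VVFun) : (Λ.rescale r).VVFun := fun τ α β μ =>
  (((r : ℝ) ^ (Λ.weightSum k k' - 1) : ℝ) : ℂ) *
    ∑ p ∈ (r : ℕ).divisorsAntidiagonal,
      ((1 / (p.2 : ℝ) ^ Λ.weightSum k k' : ℝ) : ℂ) *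
        ∑ s ∈ Finset.range p.2,
          Λ.delta p.2 μ.1 * expTwoPi (-((s : ℝ) / p.1) * (Λ.rescale r).q μ.1) *
            Λ.coeff (ψ (ofComplex ((p.1 * (τ : ℂ) + s) / p.2)) (p.1 • α + s • β) (p.2 • β))
              (p.2 • μ.1)

/-- The scaling operator `𝒰_{n²}`, from `ℂ[A]`-valued to `ℂ[A(n²)]`-valued functions: the
coefficient of `e_ν` is `Δ_{n²}(ν, n) ψ_{nν}(τ, nα, nβ)`. -/
def scaling (n : ℕ+) (ψ : Λ.VVFun) : (Λ.rescale (n ^ 2)).VVFun := fun τ α β ν =>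
  Λ.delta n ν.1 * Λ.coeff (ψ τ ((n : ℕ) • α) ((n : ℕ) • β)) ((n : ℕ) • ν.1)

theorem A_rescale_rescale {a b c : ℕ+} (h : a * b = c) :
    ((Λ.rescale a).rescale b).A = (Λ.rescale c).A := by
  subst h
  simp only [A, rescale, PNat.mul_coe, Nat.cast_mul, smul_smul, mul_comm (b : ℝ)]
  rfl

/-- The identification of `ℂ[A]`-valued functions for `L(a)(b)` and for `L(c)`, where `ab = c`: the
two lattices are equal, and each `e_μ` is identified with itself. -/
def identify {a b c : ℕ+} (h : a * b = c) (ψ : ((Λ.rescale a).rescale b).VVFun) :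
    (Λ.rescale c).VVFun := fun τ α β μ =>
  ψ τ α β ⟨μ.1, (Λ.A_rescale_rescale h).ge μ.2⟩

end EvenLattice

end

noncomputable section

/-! This is the classical Hecke algebra computation with upper triangular matrices. Extend the
coefficients of `ψ` to functions of `x ∈ V`, zero off the dual lattice (`lift`). Since `l • x ∈ L'`
exactly when the class of `x` lies in `A(l)`, the factor `Δ` is absorbed, and for `il = r` the phase
`e(-(s/i) q_r(x))` is `e(-l s q(x))`. Thus, up to powers of `r` and `l`, `𝒯_r` sums over the
matrices `(i s; 0 l)` of determinant `r` (`lift_hecke`).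

Three facts about the summands `heckeTerm` suffice. They compose like matrices: `(i' s'; 0 l')(i s;
0 l) = (ii' i's + ls'; 0 ll')`, phases included (`heckeTerm_heckeTerm`). They depend on `s` only
modulo `l`; this is where modularity enters, through `T` (`heckeTerm_add`). The scalar matrix `p`
acts as `𝒰_{p²}` (`heckeTerm_nsmul`).

What remains is counting. For coprime determinants the products run once through all classes of
determinant `mn` (`heckeSum_heckeSum_of_coprime`). For `p` and `p^(e+1)` the matrices divisible by
`p` provide an additional term, each class occurring `p` times (`heckeSum_heckeSum_prime`); that
term is what `𝒰_{p²}` removes. -/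

theorem expTwoPi_add (x y : ℝ) : expTwoPi (x + y) = expTwoPi x * expTwoPi y := by
  simp only [expTwoPi, Complex.ofReal_add, mul_add, Complex.exp_add]

theorem expTwoPi_int (n : ℤ) : expTwoPi n = 1 := by
  rw [expTwoPi, ← Complex.exp_int_mul_two_pi_mul_I n]
  congr 1
  push_cast
  ring

theorem expTwoPi_add_int (x : ℝ) (n : ℤ) : expTwoPi (x + n) = expTwoPi x := by
  rw [expTwoPi_add, expTwoPi_int, mul_one]

/-! ### Finite sums of periodic functions -/

theorem sum_range_add_of_periodic {N : ℕ} {h : ℕ → ℂ} (hh : ∀ t, h (t + N) = h t) (c : ℕ) :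
    ∑ s ∈ Finset.range N, h (s + c) = ∑ s ∈ Finset.range N, h s := by
  induction c with
  | zero => rfl
  | succ c ih =>
    have h1 := Finset.sum_range_succ (fun s => h (s + c)) N
    have h2 := Finset.sum_range_succ' (fun s => h (s + c)) N
    have h3 : h (N + c) = h (0 + c) := by rw [add_comm N c, hh, zero_add]
    rw [← ih]
    simp only [h3] at h1
    refine Eq.trans (Finset.sum_congr rfl fun s _ => ?_) (add_right_cancel (h2.symm.trans h1))
    rw [add_right_comm, add_assoc]

/-- The residues `k s + l s'` modulo `l l'` are pairwise distinct: reduction modulo `l` recovers `s`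
because `k` is invertible there, and cancelling `l` then recovers `s'` modulo `l'`. There are `l l'`
of them, so they exhaust all residues. -/
theorem sum_range_range_of_coprime {k l l' : ℕ} (hkl : Nat.Coprime k l) (hl : 0 < l)
    (hl' : 0 < l') {h : ℕ → ℂ} (hh : ∀ t, h (t + l * l') = h t) :
    ∑ s ∈ Finset.range l, ∑ s' ∈ Finset.range l', h (k * s + l * s') =
      ∑ t ∈ Finset.range (l * l'), h t := by
  have hN : 0 < l * l' := Nat.mul_pos hl hl'
  have hp : Function.Periodic h (l * l') := hh
  rw [← Finset.sum_product']
  set g : ℕ × ℕ → ℕ := fun p => (k * p.1 + l * p.2) % (l * l') with hg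
  have hmaps : ∀ p ∈ Finset.range l ×ˢ Finset.range l', g p ∈ Finset.range (l * l') :=
    fun p _ => Finset.mem_range.2 (Nat.mod_lt _ hN)
  have hinj : Set.InjOn g (Finset.range l ×ˢ Finset.range l' : Finset (ℕ × ℕ)) := by
    rintro ⟨s, s'⟩ hs ⟨t, t'⟩ ht hst
    simp only [Finset.coe_product, Finset.coe_range, Set.mem_prod, Set.mem_Iio] at hs ht
    have h1 : k * s + l * s' ≡ k * t + l * t' [MOD l * l'] := hst
    have h2 : k * s ≡ k * t [MOD l] := by
      have := h1.of_mul_right l'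
      simpa [Nat.ModEq] using this
    have h3 : s = t :=
      Nat.ModEq.eq_of_lt_of_lt (h2.cancel_left_of_coprime (hkl.symm)) hs.1 ht.1
    subst h3
    have h4 : s' ≡ t' [MOD l'] := Nat.ModEq.mul_left_cancel' hl.ne' (Nat.ModEq.add_left_cancel' _ h1)
    rw [Nat.ModEq.eq_of_lt_of_lt h4 hs.2 ht.2]
  refine Finset.sum_nbij g hmaps hinj ?_ fun p _ => (hp.map_mod_nat _).symm
  exact Finset.surjOn_of_injOn_of_card_le g hmaps hinj (by simp)

theorem sum_divisorsAntidiagonal_prime_pow {p : ℕ} (hp : p.Prime) (e : ℕ) (F : ℕ × ℕ → ℂ) :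
    ∑ d ∈ (p ^ e).divisorsAntidiagonal, F d =
      ∑ j ∈ Finset.range (e + 1), F (p ^ j, p ^ (e - j)) := by
  have h := Nat.sum_divisorsAntidiagonal (fun a b => F (a, b)) (n := p ^ e)
  simp only [Prod.mk.eta] at h
  rw [h, Nat.divisors_prime_pow hp, Finset.sum_map]
  refine Finset.sum_congr rfl fun j hj => ?_
  rw [Function.Embedding.coeFn_mk, Nat.pow_div (Nat.lt_succ_iff.1 (Finset.mem_range.1 hj)) hp.pos]

theorem sum_divisorsAntidiagonal_mul_of_coprime {m n : ℕ} (h : Nat.Coprime m n)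
    (F : ℕ × ℕ → ℂ) :
    ∑ d ∈ (m * n).divisorsAntidiagonal, F d =
      ∑ a ∈ m.divisorsAntidiagonal, ∑ b ∈ n.divisorsAntidiagonal,
        F (a.1 * b.1, a.2 * b.2) := by
  have h1 : ∀ (n : ℕ) (F : ℕ × ℕ → ℂ),
      ∑ d ∈ n.divisorsAntidiagonal, F d = ∑ d ∈ n.divisors, F (d, n / d) := fun n F =>
    Nat.sum_divisorsAntidiagonal (fun a b => F (a, b))
  simp only [h1]
  rw [Nat.divisors_mul, Finset.mul_def, Finset.sum_image h.mul_injOn_divisors,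
    Finset.sum_product]
  refine Finset.sum_congr rfl fun a ha => Finset.sum_congr rfl fun b hb => ?_
  rw [Nat.mul_div_mul_comm (Nat.dvd_of_mem_divisors ha) (Nat.dvd_of_mem_divisors hb)]

/-! ### Formal Hecke sums -/

/-- `∑_{il = r} c(l) ∑_{0 ≤ s < l} Φ(i, l, s)` -/
def heckeSum (c : ℕ → ℂ) (r : ℕ) (Φ : ℕ → ℕ → ℕ → ℂ) : ℂ :=
  ∑ d ∈ r.divisorsAntidiagonal, c d.2 * ∑ s ∈ Finset.range d.2, Φ d.1 d.2 s

/-- Each divisor of `mn` factors uniquely, which handles the diagonal entries. For fixed diagonals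
`i' ∣ n` and `l ∣ m` are coprime, so `i's + ls'` runs once through the residues modulo `ll'`. -/
theorem heckeSum_heckeSum_of_coprime {c : ℕ → ℂ} (hc : ∀ a b, c (a * b) = c a * c b)
    {Φ : ℕ → ℕ → ℕ → ℂ} (hΦ : ∀ i l s, 0 < i → 0 < l → Φ i l (s + l) = Φ i l s) {m n : ℕ}
    (h : Nat.Coprime m n) :
    heckeSum c m (fun i l s => heckeSum c n fun i' l' s' =>
      Φ (i * i') (l * l') (i' * s + l * s')) = heckeSum c (m * n) Φ := by
  rw [heckeSum, heckeSum, sum_divisorsAntidiagonal_mul_of_coprime h]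
  refine Finset.sum_congr rfl fun a ha => ?_
  simp only [heckeSum]
  rw [Finset.sum_comm, Finset.mul_sum]
  refine Finset.sum_congr rfl fun b hb => ?_
  rw [Nat.mem_divisorsAntidiagonal] at ha hb
  have ha2 : 0 < a.2 := Nat.pos_of_ne_zero fun h0 => ha.2 (by rw [← ha.1, h0, mul_zero])
  have hb2 : 0 < b.2 := Nat.pos_of_ne_zero fun h0 => hb.2 (by rw [← hb.1, h0, mul_zero])
  have ha1 : 0 < a.1 := Nat.pos_of_ne_zero fun h0 => ha.2 (by rw [← ha.1, h0, zero_mul])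
  have hb1 : 0 < b.1 := Nat.pos_of_ne_zero fun h0 => hb.2 (by rw [← hb.1, h0, zero_mul])
  have hco : Nat.Coprime b.1 a.2 :=
    (Nat.Coprime.of_dvd (Dvd.intro_left _ ha.1) (Dvd.intro _ hb.1) h).symm
  rw [← Finset.mul_sum, sum_range_range_of_coprime hco ha2 hb2 (h := Φ (a.1 * b.1) (a.2 * b.2))
    (fun t => hΦ _ _ _ (Nat.mul_pos ha1 hb1) (Nat.mul_pos ha2 hb2)), hc, mul_assoc]

/-- The outer factor has diagonal `(1, p)` or `(p, 1)`. The products with `(p, 1)`, together with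
those of `(1, p)` with `(1, p^(e+1))`, give each class of determinant `p^(e+2)` once. In all other
products with `(1, p)` every entry is divisible by `p`, and these form the correction term. -/
theorem heckeSum_heckeSum_prime {c : ℕ → ℂ} (hc : ∀ a b, c (a * b) = c a * c b)
    (hc1 : c 1 = 1)
    {Φ : ℕ → ℕ → ℕ → ℂ} (hΦ : ∀ i l s, 0 < i → 0 < l → Φ i l (s + l) = Φ i l s) {p : ℕ} (hp : p.Prime)
    (e : ℕ) :
    heckeSum c p (fun i l s => heckeSum c (p ^ (e + 1)) fun i' l' s' =>
      Φ (i * i') (l * l') (i' * s + l * s')) =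
      heckeSum c (p ^ (e + 2)) Φ +
        p * c p * heckeSum c (p ^ e) fun i l s => Φ (p * i) (p * l) (p * s) := by
  have hpp : ∀ F : ℕ × ℕ → ℂ, ∑ d ∈ p.divisorsAntidiagonal, F d = F (1, p) + F (p, 1) := by
    intro F
    have := sum_divisorsAntidiagonal_prime_pow hp 1 F
    simpa [Finset.sum_range_succ] using this
  have hpos : ∀ j, 0 < p ^ j := fun j => pow_pos hp.pos j
  rw [heckeSum, hpp]
  simp only [heckeSum, sum_divisorsAntidiagonal_prime_pow hp, Finset.sum_range_one, mul_zero, hc1,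
    one_mul, zero_add]
  -- Contribution of the outer diagonal `(1, p)`, split into `j = 0`, where `i' = 1` is coprime to
  -- `p`, and `j ≥ 1`, where `p ∣ i'`.
  have hA : ∑ s ∈ Finset.range p, ∑ j ∈ Finset.range (e + 1 + 1), c (p ^ (e + 1 - j)) *
        ∑ s' ∈ Finset.range (p ^ (e + 1 - j)),
          Φ (p ^ j) (p * p ^ (e + 1 - j)) (p ^ j * s + p * s') =
      c (p ^ (e + 1)) * ∑ t ∈ Finset.range (p * p ^ (e + 1)), Φ 1 (p * p ^ (e + 1)) t +
        p * ∑ j ∈ Finset.range (e + 1), c (p ^ (e - j)) * ∑ s ∈ Finset.range (p ^ (e - j)),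
          Φ (p * p ^ j) (p * p ^ (e - j)) (p * s) := by
    rw [Finset.sum_comm, Finset.sum_range_succ', add_comm]
    congr 1
    · rw [← Finset.mul_sum]
      congr 1
      exact sum_range_range_of_coprime (k := p ^ 0) (by simp) hp.pos (hpos _)
        (h := Φ 1 (p * p ^ (e + 1))) (fun t => hΦ _ _ _ one_pos (Nat.mul_pos hp.pos (hpos _)))
    · rw [Finset.mul_sum]
      refine Finset.sum_congr rfl fun j _ => ?_
      rw [← Finset.mul_sum, mul_left_comm, Nat.add_sub_add_right, pow_succ' p j]
      congr 1
      have hper : ∀ t, Φ (p * p ^ j) (p * p ^ (e - j)) (p * (t + p ^ (e - j))) =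
          Φ (p * p ^ j) (p * p ^ (e - j)) (p * t) := fun t => by
        rw [mul_add]; exact hΦ _ _ _ (Nat.mul_pos hp.pos (hpos _)) (Nat.mul_pos hp.pos (hpos _))
      -- The upper right entry is `p (p^j s + s')`, so `s` merely shifts `s'`. The inner sum is thus
      -- independent of `s`, and summing over `s` yields the factor `p`.
      have hconst : ∀ s, ∑ s' ∈ Finset.range (p ^ (e - j)),
          Φ (p * p ^ j) (p * p ^ (e - j)) (p * p ^ j * s + p * s') =
            ∑ s' ∈ Finset.range (p ^ (e - j)),
              Φ (p * p ^ j) (p * p ^ (e - j)) (p * s') := by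
        intro s
        rw [← sum_range_add_of_periodic
          (h := fun t => Φ (p * p ^ j) (p * p ^ (e - j)) (p * t)) hper (p ^ j * s)]
        refine Finset.sum_congr rfl fun s' _ => ?_
        congr 1
        ring
      rw [Finset.sum_congr rfl fun s _ => hconst s, Finset.sum_const, Finset.card_range,
        nsmul_eq_mul]
  -- In the sum for `p^(e+2)`, the term with `i = 1` matches the first summand of `hA`; the terms
  -- with `p ∣ i` match the outer diagonal `(p, 1)`.
  rw [hA, Finset.sum_range_succ' _ (e + 2)]
  have hB : ∀ j, e + 2 - (j + 1) = e + 1 - j := fun j => by omega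
  simp only [hB, Nat.sub_zero, pow_zero, pow_succ' p, hc]
  ring
-- Invariance of the signature under positive rescaling.
variable {V : Type*} [NormedAddCommGroup V] [NormedSpace ℝ V] [FiniteDimensional ℝ V]

/-- Multiplication by `√r` is an isometry from `r • Q` to `Q`. -/
theorem sigPos_smul {Q : QuadraticForm ℝ V} {r : ℝ} (hr : 0 < r) : sigPos (r • Q) = sigPos Q := by
  refine QuadraticMap.Equivalent.sigPos_eq
    ⟨⟨LinearEquiv.smulOfNeZero ℝ V (Real.sqrt r) (Real.sqrt_pos.2 hr).ne', fun x => ?_⟩⟩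
  simp [QuadraticMap.map_smul, Real.mul_self_sqrt hr.le]

namespace EvenLattice

variable (Λ : EvenLattice V)

/-- Iterated Hecke operators on `L(r)` therefore use the same exponent `w + w̄`. For `b⁻` the
argument for `b⁺` is applied to the negated form. -/
theorem weightSum_rescale (r : ℕ+) (k k' : ℤ) :
    (Λ.rescale r).weightSum k k' = Λ.weightSum k k' := by
  have hr : (0 : ℝ) < r := by exact_mod_cast r.pos
  have hQ : LinearMap.BilinMap.toQuadraticMap (Λ.rescale r).form =
      (r : ℝ) • LinearMap.BilinMap.toQuadraticMap Λ.form := by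
    ext x; simp [rescale]
  have h1 : (Λ.rescale r).bPos = Λ.bPos := by
    rw [bPos, bPos, hQ, sigPos_smul hr]
  have h2 : (Λ.rescale r).bNeg = Λ.bNeg := by
    rw [bNeg, bNeg, hQ, ← sigPos_neg, ← sigPos_neg,
      ← sigPos_smul (Q := -LinearMap.BilinMap.toQuadraticMap Λ.form) hr]
    congr 1
    ext x
    simp
  rw [weightSum, weightSum, h1, h2]

/-! ### Coefficients as functions on `V`. -/

theorem le_dual : Λ.L ≤ Λ.form.dualSubmodule Λ.L := fun x hx y hy => by
  obtain ⟨n, hn⟩ := Λ.integral x hx y hy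
  exact Submodule.mem_one.2 ⟨n, by simp [hn]⟩

theorem mkQ_mem_A {x : V} : Λ.L.mkQ x ∈ Λ.A ↔ x ∈ Λ.form.dualSubmodule Λ.L := by
  refine ⟨?_, fun h => ⟨x, h, rfl⟩⟩
  rintro ⟨y, hy, hxy⟩
  have : x - y ∈ Λ.L := (Submodule.Quotient.eq _).1 hxy.symm
  simpa using add_mem (Λ.le_dual this) hy

theorem smul_mem_dual {B : LinearMap.BilinForm ℝ V} {L : Submodule ℤ V} {l : ℕ} {x : V} :
    l • x ∈ B.dualSubmodule L ↔ x ∈ ((l : ℝ) • B).dualSubmodule L := by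
  simp [LinearMap.BilinForm.mem_dualSubmodule]

theorem mkQ_mem_discGroup_smul {l : ℕ} (hl : 0 < l) {x : V} :
    Λ.L.mkQ x ∈ discGroup ((l : ℝ) • Λ.form) Λ.L ↔ l • x ∈ Λ.form.dualSubmodule Λ.L :=
  ((Λ.rescale ⟨l, hl⟩).mkQ_mem_A).trans smul_mem_dual.symm

/-- The coefficients of a `ℂ[A]`-valued function as functions on `V`, with the value `0` off the
dual lattice, and with the first variable in `ℂ`. -/
def lift (ψ : Λ.VVFun) (z : ℂ) (α β x : V) : ℂ :=
  Λ.coeff (ψ (ofComplex z) α β) (Λ.L.mkQ x)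

theorem lift_of_mem {ψ : Λ.VVFun} {z : ℂ} {α β x : V} (hx : x ∈ Λ.form.dualSubmodule Λ.L) :
    Λ.lift ψ z α β x = ψ (ofComplex z) α β ⟨Λ.L.mkQ x, Λ.mkQ_mem_A.2 hx⟩ := by
  simp only [lift, coeff]
  exact dif_pos (Λ.mkQ_mem_A.2 hx)

theorem lift_of_notMem {ψ : Λ.VVFun} {z : ℂ} {α β x : V} (hx : x ∉ Λ.form.dualSubmodule Λ.L) :
    Λ.lift ψ z α β x = 0 := by
  simp only [lift, coeff]
  exact dif_neg fun h => hx (Λ.mkQ_mem_A.1 h)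

theorem ext_lift {ψ χ : Λ.VVFun}
    (h : ∀ z : ℂ, 0 < z.im → ∀ α β, ∀ x ∈ Λ.form.dualSubmodule Λ.L,
      Λ.lift ψ z α β x = Λ.lift χ z α β x) : ψ = χ := by
  funext τ α β μ
  obtain ⟨_, x, hx, rfl⟩ := μ
  have := h τ τ.im_pos α β x hx
  rwa [lift_of_mem _ hx, lift_of_mem _ hx, ofComplex_apply] at this

theorem lift_sub_smul (c : ℂ) (ψ χ : Λ.VVFun) (z : ℂ) (α β x : V) :
    Λ.lift (ψ - c • χ) z α β x = Λ.lift ψ z α β x - c * Λ.lift χ z α β x := by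
  by_cases hx : x ∈ Λ.form.dualSubmodule Λ.L
  · simp [lift_of_mem _ hx]
  · simp [lift_of_notMem _ hx]

/-! ### Periodicity and composition of the Hecke terms. -/

/-- The formal terms of the Hecke operators. -/
def heckeTerm (N : ℕ) (f : ℂ → V → V → V → ℂ) (z : ℂ) (α β x : V) (i l s : ℕ) : ℂ :=
  expTwoPi (-(N * l * s * (Λ.form x x / 2))) *
    f ((i * z + s) / l) (i • α + s • β) (l • β) (l • x)

theorem lift_add_one {ψ : Λ.VVFun} {k k' : ℤ} (hψ : Λ.IsModular k k' ψ) {z : ℂ} (hz : 0 < z.im)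
    (α β x : V) :
    Λ.lift ψ (z + 1) (α + β) β x = expTwoPi (Λ.form x x / 2) * Λ.lift ψ z α β x := by
  by_cases hx : x ∈ Λ.form.dualSubmodule Λ.L
  · have hz1 : 0 < (z + 1).im := by simpa using hz
    have hT : ofComplex (z + 1) = Mp2Z.T.mat • ofComplex z := by
      rw [show Mp2Z.T.mat = ModularGroup.T from rfl, modular_T_smul]
      ext1
      rw [coe_vadd, ofComplex_apply_of_im_pos hz, ofComplex_apply_of_im_pos hz1]
      simp [add_comm]
    have h := hψ.transform Mp2Z.T Λ.weilT (Submonoid.subset_closure (by simp)) (ofComplex z) α β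
    have hm : Mp2Z.T.mat 0 0 = 1 ∧ Mp2Z.T.mat 0 1 = 1 ∧ Mp2Z.T.mat 1 0 = 0 ∧
        Mp2Z.T.mat 1 1 = 1 := by
      simp [Mp2Z.T, ModularGroup.T]
    have hr : ∀ τ, Mp2Z.T.root τ = 1 := fun _ => rfl
    obtain ⟨h1, h2, h3, h4⟩ := hm
    rw [h1, h2, h3, h4, hr, ← hT] at h
    simp only [one_smul, zero_smul, zero_add, one_zpow, map_one, mul_one] at h
    obtain ⟨n, hn⟩ := Λ.q_eq x hx
    rw [lift_of_mem _ hx, lift_of_mem _ hx, h, ← expTwoPi_add_int _ n, ← hn]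
    simp [weilT]
  · rw [lift_of_notMem _ hx, lift_of_notMem _ hx, mul_zero]

theorem im_heckePoint_pos {z : ℂ} (hz : 0 < z.im) {i l : ℕ} (s : ℕ) (hi : 0 < i) (hl : 0 < l) :
    0 < ((i * z + s) / l : ℂ).im := by
  rw [Complex.div_natCast_im]
  have hi' : (0 : ℝ) < i := by exact_mod_cast hi
  have hl' : (0 : ℝ) < l := by exact_mod_cast hl
  simpa using div_pos (mul_pos hi' hz) hl'

/-- Replacing `s` by `s + l` moves the argument of `ψ` by `T`, which produces `e(q(lx)) = e(l²
q(x))`. The phase `e(-l(s + l) q(x))` contains exactly the inverse factor. -/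
theorem heckeTerm_add {ψ : Λ.VVFun} {k k' : ℤ} (hψ : Λ.IsModular k k' ψ) {z : ℂ} (hz : 0 < z.im)
    (α β x : V) (i l s : ℕ) (hi : 0 < i) (hl : 0 < l) :
    Λ.heckeTerm 1 (Λ.lift ψ) z α β x i l (s + l) = Λ.heckeTerm 1 (Λ.lift ψ) z α β x i l s := by
  have hl' : (l : ℂ) ≠ 0 := by exact_mod_cast hl.ne'
  have h1 : (i * z + (s + l : ℕ)) / l = (i * z + s) / l + 1 := by
    push_cast
    field_simp
    ring
  rw [heckeTerm, heckeTerm, h1, add_smul s l β, ← add_assoc,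
    Λ.lift_add_one hψ (im_heckePoint_pos hz s hi hl), ← mul_assoc, ← expTwoPi_add]
  congr 2
  simp
  ring

/-- Composition of the terms of two Hecke operators. -/
theorem heckeTerm_heckeTerm (f : ℂ → V → V → V → ℂ) (z : ℂ) (α β x : V) (i l s i' l' s' : ℕ)
    (hl : 0 < l) (hl' : 0 < l') :
    expTwoPi (-((i' * l' : ℕ) * l * s * (Λ.form x x / 2))) *
      Λ.heckeTerm 1 f ((i * z + s) / l) (i • α + s • β) (l • β) (l • x) i' l' s' =
        Λ.heckeTerm 1 f z α β x (i * i') (l * l') (i' * s + l * s') := by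
  have hl0 : (l : ℂ) ≠ 0 := by exact_mod_cast hl.ne'
  have hl0' : (l' : ℂ) ≠ 0 := by exact_mod_cast hl'.ne'
  rw [heckeTerm, heckeTerm, ← mul_assoc, ← expTwoPi_add]
  -- The phases match because `i'l' · ls + l's' · l² = ll'(i's + ls')`; the `l²` comes from
  -- evaluating `q` at `l • x`.
  congr 2
  · simp
    ring
  · push_cast
    field_simp
    ring
  · module
  · module
  · module

/-! ### The Hecke and scaling operators on lifted coefficients. -/

theorem lift_hecke (r : ℕ+) (k k' : ℤ) (ψ : Λ.VVFun) {z : ℂ} (hz : 0 < z.im) (α β x : V) :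
    (Λ.rescale r).lift (Λ.hecke k k' r ψ) z α β x =
      (((r : ℝ) ^ (Λ.weightSum k k' - 1) : ℝ) : ℂ) *
        heckeSum (fun l => ((1 / (l : ℝ) ^ Λ.weightSum k k' : ℝ) : ℂ)) r
          (Λ.heckeTerm 1 (Λ.lift ψ) z α β x) := by
  have key : ∀ p ∈ (r : ℕ).divisorsAntidiagonal, ∀ s : ℕ,
      Λ.delta p.2 (Λ.L.mkQ x) * expTwoPi (-((s : ℝ) / p.1) * (Λ.rescale r).q (Λ.L.mkQ x)) *
        Λ.coeff (ψ (ofComplex ((p.1 * z + s) / p.2)) (p.1 • α + s • β) (p.2 • β))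
          (p.2 • Λ.L.mkQ x) = Λ.heckeTerm 1 (Λ.lift ψ) z α β x p.1 p.2 s := by
    rintro ⟨i, l⟩ hp s
    have hi : 0 < i := Nat.pos_of_ne_zero (Nat.left_ne_zero_of_mem_divisorsAntidiagonal hp)
    have hl : 0 < l := Nat.pos_of_ne_zero (Nat.right_ne_zero_of_mem_divisorsAntidiagonal hp)
    rw [Nat.mem_divisorsAntidiagonal] at hp
    rw [heckeTerm, ← map_nsmul, ← lift]
    by_cases hx : l • x ∈ Λ.form.dualSubmodule Λ.L
    · have hd : Λ.delta l (Λ.L.mkQ x) = 1 := if_pos ((Λ.mkQ_mem_discGroup_smul hl).2 hx)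
      obtain ⟨n, hn⟩ := Λ.phase_eq ⟨i, hi⟩ ⟨l, hl⟩ r (PNat.eq hp.1) s x (smul_mem_dual.1 hx)
      have hn' : -((s : ℝ) / i) * (Λ.rescale r).q (Λ.L.mkQ x) =
          -((1 : ℕ) * l * s * (Λ.form x x / 2)) + (-n : ℤ) := by
        rw [neg_mul]
        erw [hn]
        push_cast
        simp only [PNat.mk_coe]
        ring
      rw [hd, hn', expTwoPi_add_int, one_mul]
    · rw [lift_of_notMem _ hx, mul_zero, mul_zero]
  have hcoe : ((ofComplex z : ℍ) : ℂ) = z := by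
    rw [ofComplex_apply_of_im_pos hz]
  by_cases hx : x ∈ (Λ.rescale r).form.dualSubmodule (Λ.rescale r).L
  · rw [lift_of_mem _ hx]
    simp only [hecke, hcoe, heckeSum]
    congr 1
    refine Finset.sum_congr rfl fun p hp => ?_
    congr 1
    exact Finset.sum_congr rfl fun s _ => key p hp s
  · rw [lift_of_notMem _ hx, heckeSum, Finset.sum_eq_zero, mul_zero]
    intro p hp
    rw [Finset.sum_eq_zero, mul_zero]
    intro s _
    -- Off `L(r)'` every term vanishes: if `l • x` were in `L'`, so would be `i • l • x = r • x`.
    have : p.2 • x ∉ Λ.form.dualSubmodule Λ.L := by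
      intro h
      apply hx
      refine smul_mem_dual.1 ?_
      rw [← (Nat.mem_divisorsAntidiagonal.1 hp).1, mul_smul]
      exact nsmul_mem h _
    rw [heckeTerm, lift_of_notMem _ this, mul_zero]

/-- The outer operator in a composition lives on `L(n)`, whose form contributes the factor `n =
i'l'` required by `heckeTerm_heckeTerm`. -/
theorem heckeTerm_rescale (n : ℕ+) (f : ℂ → V → V → V → ℂ) (z : ℂ) (α β x : V) (i l s : ℕ) :
    (Λ.rescale n).heckeTerm 1 f z α β x i l s = Λ.heckeTerm n f z α β x i l s := by
  simp only [heckeTerm, rescale, LinearMap.smul_apply, smul_eq_mul]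
  congr 3
  push_cast
  ring

theorem lift_identify {a b c : ℕ+} (h : a * b = c) (ψ : ((Λ.rescale a).rescale b).VVFun) (z : ℂ)
    (α β x : V) :
    (Λ.rescale c).lift (Λ.identify h ψ) z α β x =
      ((Λ.rescale a).rescale b).lift ψ z α β x := by
  have hA : x ∈ (Λ.rescale c).form.dualSubmodule (Λ.rescale c).L ↔
      x ∈ ((Λ.rescale a).rescale b).form.dualSubmodule ((Λ.rescale a).rescale b).L := by
    rw [← mkQ_mem_A, ← mkQ_mem_A]
    exact (SetLike.ext_iff.1 (Λ.A_rescale_rescale h) _).symm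
  by_cases hx : x ∈ (Λ.rescale c).form.dualSubmodule (Λ.rescale c).L
  · rw [lift_of_mem _ hx, lift_of_mem _ (hA.1 hx)]
    rfl
  · rw [lift_of_notMem _ hx, lift_of_notMem _ (fun h => hx (hA.2 h))]

theorem lift_scaling (n : ℕ+) (ψ : Λ.VVFun) (z : ℂ) (α β x : V) :
    (Λ.rescale (n ^ 2)).lift (Λ.scaling n ψ) z α β x =
      Λ.lift ψ z ((n : ℕ) • α) ((n : ℕ) • β) ((n : ℕ) • x) := by
  by_cases hn : (n : ℕ) • x ∈ Λ.form.dualSubmodule Λ.L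
  · have hx : x ∈ (Λ.rescale (n ^ 2)).form.dualSubmodule (Λ.rescale (n ^ 2)).L := by
      refine smul_mem_dual.1 ?_
      rw [PNat.pow_coe, pow_two (n : ℕ), mul_smul]
      exact nsmul_mem hn _
    rw [lift_of_mem _ hx, scaling]
    have hd : Λ.delta n (Λ.L.mkQ x) = 1 := if_pos ((Λ.mkQ_mem_discGroup_smul n.pos).2 hn)
    erw [hd]
    rw [one_mul, lift, map_nsmul]
    rfl
  · rw [lift_of_notMem _ hn]
    by_cases hx : x ∈ (Λ.rescale (n ^ 2)).form.dualSubmodule (Λ.rescale (n ^ 2)).L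
    · rw [lift_of_mem _ hx, scaling]
      have hd : Λ.delta n (Λ.L.mkQ x) = 0 :=
        if_neg fun h => hn ((Λ.mkQ_mem_discGroup_smul n.pos).1 h)
      erw [hd]
      rw [zero_mul]
    · exact lift_of_notMem _ hx

/-- The iterated Hecke operator. -/
theorem lift_hecke_hecke (m n : ℕ+) (k k' : ℤ) (ψ : Λ.VVFun) {z : ℂ} (hz : 0 < z.im)
    (α β x : V) :
    ((Λ.rescale n).rescale m).lift ((Λ.rescale n).hecke k k' m (Λ.hecke k k' n ψ)) z α β x =
      ((((m : ℝ) ^ (Λ.weightSum k k' - 1) * (n : ℝ) ^ (Λ.weightSum k k' - 1) : ℝ)) : ℂ) *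
        heckeSum (fun l => ((1 / (l : ℝ) ^ Λ.weightSum k k' : ℝ) : ℂ)) m fun i l s =>
          heckeSum (fun l => ((1 / (l : ℝ) ^ Λ.weightSum k k' : ℝ) : ℂ)) n fun i' l' s' =>
            Λ.heckeTerm 1 (Λ.lift ψ) z α β x (i * i') (l * l') (i' * s + l * s') := by
  rw [lift_hecke _ _ _ _ _ hz, weightSum_rescale, Complex.ofReal_mul, mul_assoc]
  congr 1
  simp only [heckeSum]
  rw [Finset.mul_sum]
  refine Finset.sum_congr rfl fun d hd => ?_
  have hi : 0 < d.1 := Nat.pos_of_ne_zero (Nat.left_ne_zero_of_mem_divisorsAntidiagonal hd)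
  have hl : 0 < d.2 := Nat.pos_of_ne_zero (Nat.right_ne_zero_of_mem_divisorsAntidiagonal hd)
  rw [mul_left_comm]
  congr 1
  rw [Finset.mul_sum]
  refine Finset.sum_congr rfl fun s _ => ?_
  rw [heckeTerm_rescale, heckeTerm, lift_hecke _ _ _ _ _ (im_heckePoint_pos hz s hi hl),
    mul_left_comm]
  congr 1
  rw [heckeSum, Finset.mul_sum]
  refine Finset.sum_congr rfl fun d' hd' => ?_
  have hl' : 0 < d'.2 := Nat.pos_of_ne_zero (Nat.right_ne_zero_of_mem_divisorsAntidiagonal hd')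
  rw [mul_left_comm]
  congr 1
  rw [Finset.mul_sum]
  refine Finset.sum_congr rfl fun s' _ => ?_
  rw [← Λ.heckeTerm_heckeTerm _ _ _ _ _ _ _ _ _ _ _ hl hl',
    (Nat.mem_divisorsAntidiagonal.1 hd').1]

/-- The scalar matrix `p` fixes the point of `ℍ`, and `l s q(px) = (pl)(ps) q(x)`. -/
theorem heckeTerm_nsmul (f : ℂ → V → V → V → ℂ) (z : ℂ) (α β x : V) {p : ℕ} (hp : 0 < p)
    (i l s : ℕ) :
    Λ.heckeTerm 1 f z (p • α) (p • β) (p • x) i l s =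
      Λ.heckeTerm 1 f z α β x (p * i) (p * l) (p * s) := by
  have hp0 : (p : ℂ) ≠ 0 := by exact_mod_cast hp.ne'
  rw [heckeTerm, heckeTerm]
  congr 2
  · simp
    ring_nf
  · push_cast
    rw [mul_assoc, ← mul_add, mul_div_mul_left _ _ hp0]
  · module
  · module
  · module

end EvenLattice

theorem one_div_rpow_mul (w : ℝ) (a b : ℕ) :
    ((1 / ((a * b : ℕ) : ℝ) ^ w : ℝ) : ℂ) = ((1 / (a : ℝ) ^ w : ℝ) : ℂ) *
      ((1 / (b : ℝ) ^ w : ℝ) : ℂ) := by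
  rw [Nat.cast_mul, Real.mul_rpow (Nat.cast_nonneg _) (Nat.cast_nonneg _)]
  push_cast
  rw [one_div_mul_one_div]

end

/-! ### The two Hecke relations. -/

theorem theoremt {V : Type*} [NormedAddCommGroup V] [NormedSpace ℝ V] [FiniteDimensional ℝ V]
    (Λ : EvenLattice V) (k k' : ℤ) (ψ : Λ.VVFun) (hψ : Λ.IsModular k k' ψ) :
    (∀ m n : ℕ+, Nat.Coprime m n →
      Λ.identify (mul_comm n m) ((Λ.rescale n).hecke k k' m (Λ.hecke k k' n ψ)) =
        Λ.hecke k k' (m * n) ψ) ∧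
    (∀ (p : ℕ+) (l : ℕ), Nat.Prime p → ∀ hl : 2 ≤ l,
      Λ.hecke k k' (p ^ l) ψ =
        Λ.identify (pow_sub_one_mul (by omega) p)
            ((Λ.rescale (p ^ (l - 1))).hecke k k' p (Λ.hecke k k' (p ^ (l - 1)) ψ)) -
          (((p : ℝ) ^ (Λ.weightSum k k' - 1) : ℝ) : ℂ) •
            Λ.identify (pow_sub_mul_pow p hl)
              ((Λ.rescale (p ^ (l - 2))).scaling p (Λ.hecke k k' (p ^ (l - 2)) ψ))) := by
  have hc := one_div_rpow_mul (Λ.weightSum k k')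
  have hc1 : ((1 / ((1 : ℕ) : ℝ) ^ Λ.weightSum k k' : ℝ) : ℂ) = 1 := by simp
  refine ⟨fun m n hmn => ?_, fun p l hp hl => ?_⟩
  · refine EvenLattice.ext_lift _ fun z hz α β x _ => ?_
    have hΦ := fun i l s => Λ.heckeTerm_add hψ hz α β x i l s
    rw [EvenLattice.lift_identify, EvenLattice.lift_hecke_hecke _ _ _ _ _ _ hz,
      EvenLattice.lift_hecke _ _ _ _ _ hz, heckeSum_heckeSum_of_coprime hc hΦ hmn,
      PNat.mul_coe, Nat.cast_mul, Real.mul_rpow (Nat.cast_nonneg _) (Nat.cast_nonneg _)]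
  · obtain ⟨e, rfl⟩ := Nat.exists_eq_add_of_le' hl
    have hp0 : (0 : ℝ) < p := by exact_mod_cast p.pos
    refine EvenLattice.ext_lift _ fun z hz α β x _ => ?_
    have hΦ := fun i l s => Λ.heckeTerm_add hψ hz α β x i l s
    rw [EvenLattice.lift_sub_smul, EvenLattice.lift_identify, EvenLattice.lift_identify,
      EvenLattice.lift_scaling, EvenLattice.lift_hecke_hecke _ _ _ _ _ _ hz,
      EvenLattice.lift_hecke _ _ _ _ _ hz, EvenLattice.lift_hecke _ _ _ _ _ hz]
    have hU : Λ.heckeTerm 1 (Λ.lift ψ) z ((p : ℕ) • α) ((p : ℕ) • β) ((p : ℕ) • x) =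
        fun i l s => Λ.heckeTerm 1 (Λ.lift ψ) z α β x (p * i) (p * l) (p * s) := by
      funext i l s
      exact Λ.heckeTerm_nsmul _ _ _ _ _ p.pos i l s
    rw [hU]
    have h1 : ((p ^ (e + 2 - 1) : ℕ+) : ℕ) = (p : ℕ) ^ (e + 1) := PNat.pow_coe _ _
    have h2 : ((p ^ (e + 2 - 2) : ℕ+) : ℕ) = (p : ℕ) ^ e := PNat.pow_coe _ _
    rw [h1, h2, PNat.pow_coe, heckeSum_heckeSum_prime hc hc1 hΦ hp]
    have hpow : ∀ j : ℕ, (((p : ℕ) ^ j : ℕ) : ℝ) ^ (Λ.weightSum k k' - 1) =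
        ((p : ℝ) ^ (Λ.weightSum k k' - 1)) ^ j := fun j => by
      rw [Nat.cast_pow, ← Real.rpow_natCast, ← Real.rpow_mul hp0.le, mul_comm, Real.rpow_mul hp0.le,
        Real.rpow_natCast]
    -- The multiplicity `p` and the weight `c p` of the correction term cancel one of the `e + 2`
    -- prefactors `p^(w+w̄-1)`. Of the remaining `e + 1`, one is the coefficient of `𝒰_{p²}` and the
    -- others normalize `𝒯_{p^e}`.
    have hw : ((p : ℕ) : ℂ) * ((1 / (p : ℝ) ^ Λ.weightSum k k' : ℝ) : ℂ) *
        (((p : ℝ) ^ (Λ.weightSum k k' - 1) : ℝ) : ℂ) = 1 := by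
      have : (p : ℝ) * (1 / (p : ℝ) ^ Λ.weightSum k k') * (p : ℝ) ^ (Λ.weightSum k k' - 1) = 1 := by
        rw [Real.rpow_sub_one hp0.ne']
        have := (Real.rpow_pos_of_pos hp0 (Λ.weightSum k k')).ne'
        field_simp
      exact_mod_cast this
    simp only [hpow, Complex.ofReal_mul, Complex.ofReal_pow]
    set S := heckeSum (fun l => ((1 / (l : ℝ) ^ Λ.weightSum k k' : ℝ) : ℂ)) ((p : ℕ) ^ e)
      fun i l s => Λ.heckeTerm 1 (Λ.lift ψ) z α β x (p * i) (p * l) (p * s)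
    linear_combination (-(((p : ℝ) ^ (Λ.weightSum k k' - 1) : ℝ) : ℂ) ^ (e + 1) * S) * hw
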